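/- **Setting.** Let $f$ be a speed function on $[0,1]^n$ with $0<F_1\le f\le F_2$, and let $s,t\in[0,1]^n$. A trajectory from $s$ to $t$ is a solution $y:[0,T]\to[0,1]^n$ of $\dot y(\tau)=f(y(\tau))\,a(\tau)$, $y(0)=s$, with a measurable control $a$, $|a(\tau)|=1$, where $T$ is the first time with $y(T)=t$; it is optimal if $T$ is minimal. Assume that the optimal trajectory from $s$ to $t$ exists and is unique, and let $d(x)$ denote the distance from $x$ to it. Let $h\to0$ along a sequence of values $h=1/(m-1)$, $m\ge 2$ an integer, such that $s$ and $t$ are points of the uniform Cartesian grid $X^h$ with $m$ points per side on $[0,1]^n$. For a set $Y\subset X^h$ of gridpoints, an exit set $Q$ and boundary values $q$ on $Q$, a (finite) solution of the upwind system on $Y$ is a function $U$ with $U=q$ on $Q$ and $$\sum_{k=1}^n\Big(\max\{D^{-k}U(x),\,-D^{+k}U(x),\,0\}\Big)^2=\frac1{f(x)^2}\qquad (x\in Y\setminus Q),\qquad D^{\pm k}U(x)=\frac{U(x\pm he_k)-U(x)}{\pm h},$$ where neighbors outside $Y$ carry the value $+\infty$ (they are omitted from the maximum). Let $0\le\mu<\frac12$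 and let $r=r(h)$ be of exact order $h^\mu$, i.e. $c\,h^\mu\le r\le C\,h^\mu$ for small $h$ with constants $c,C>0$. Put $\hat X^h=\{x\in X^h: d(x)<r\}$. For all small $h$ let $U^h$ and $\hat U^h$ be solutions of the upwind system on $X^h$ and on $\hat X^h$, respectively, both with $Q=\{t\}$ and $q(t)=0$. Assume that, for small $h$, the upwind neighbors for $U^h$ are unique: if $x\in X^h\setminus\{t\}$ and $x\pm he_k\in X^h$ satisfy $U^h(x-he_k)=U^h(x+he_k)$, then this common value is at least $U^h(x)$. For $x\in X^h\setminus\{t\}$ let the sensitivity coefficient $\alpha^h(x)$ be the derivative, with respect to $q$ at $q=U^h(x)$, of the value at $s$ of the solution of the upwind system on $X^h$ with exit set $\{t,x\}$, boundary value $0$ at $t$ and boundary value $q$ at $x$. **Theorem.** Suppose that (Conjecture) there is a constant $\rho>0$ such that, for all small enough $h$, $\alpha^h(x)\le e^{-\rho\, d(x)^2/h}$ for all $x\in X^h\setminus\{t\}$. Then $\hat U^h(s)-U^h(s)\to0$ as $h\to0$. -/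

import Mathlib

open Filter Topology MeasureTheory

/-- The closed unit cube `[0,1]^n`, the closure of the computational domain. -/
def unitCube (n : ℕ) : Set (EuclideanSpace ℝ (Fin n)) :=
  {x | ∀ k, 0 ≤ x k ∧ x k ≤ 1}

/-- `y : [0,T] → [0,1]^n` is a trajectory of the controlled system `y' = f(y) a`, `y(0) = s`, for
some measurable control `a` with values in the unit sphere; it stays in the closed unit cube and
`T` is the time at which it first reaches the target `t`.
The differential equation is understood in the Carathéodory (integrated) sense. -/
structure IsTrajectory {n : ℕ} (f : EuclideanSpace ℝ (Fin n) → ℝ)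
    (s t : EuclideanSpace ℝ (Fin n)) (T : ℝ) (y : ℝ → EuclideanSpace ℝ (Fin n)) : Prop where
  nonneg : 0 ≤ T
  mem_cube : ∀ τ ∈ Set.Icc (0 : ℝ) T, y τ ∈ unitCube n
  dynamics : ∃ a : ℝ → EuclideanSpace ℝ (Fin n), Measurable a ∧ (∀ τ, ‖a τ‖ = 1) ∧
    IntervalIntegrable (fun τ => f (y τ) • a τ) volume 0 T ∧
    ∀ τ ∈ Set.Icc (0 : ℝ) T, y τ = s + ∫ v in (0 : ℝ)..τ, f (y v) • a v
  arrival : y T = t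
  first_arrival : ∀ τ ∈ Set.Ico (0 : ℝ) T, y τ ≠ t

/-- A time-optimal trajectory from `s` to `t` inside the closed unit cube. -/
def IsOptimalTrajectory {n : ℕ} (f : EuclideanSpace ℝ (Fin n) → ℝ)
    (s t : EuclideanSpace ℝ (Fin n)) (T : ℝ) (y : ℝ → EuclideanSpace ℝ (Fin n)) : Prop :=
  IsTrajectory f s t T y ∧ ∀ T' y', IsTrajectory f s t T' y' → T ≤ T'

/-- The uniform Cartesian grid on `[0,1]^n` with `N + 1` gridpoints per side, so that the
spacing is `1 / N`. -/
def cartesianGrid (n N : ℕ) : Set (EuclideanSpace ℝ (Fin n)) :=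
  {x | ∀ k, ∃ i : ℕ, i ≤ N ∧ x k = (i : ℝ) / (N : ℝ)}

/-- The neighbor of `x` in the positive direction of the `k`-th axis. -/
noncomputable def nextPoint {n : ℕ} (h : ℝ) (x : EuclideanSpace ℝ (Fin n)) (k : Fin n) :
    EuclideanSpace ℝ (Fin n) :=
  x + h • EuclideanSpace.single k (1 : ℝ)

/-- The neighbor of `x` in the negative direction of the `k`-th axis. -/
noncomputable def prevPoint {n : ℕ} (h : ℝ) (x : EuclideanSpace ℝ (Fin n)) (k : Fin n) :
    EuclideanSpace ℝ (Fin n) :=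
  x - h • EuclideanSpace.single k (1 : ℝ)

open Classical in
/-- The upwind difference `max {D⁻U, -D⁺U, 0}` at `x` along the `k`-th axis, for a grid function
on the set `Y` of gridpoints.  A neighbor outside `Y` carries the value `+∞`, so that its
difference quotient `-∞` drops out of the maximum. -/
noncomputable def upwindDiff {n : ℕ} (h : ℝ) (Y : Set (EuclideanSpace ℝ (Fin n)))
    (U : EuclideanSpace ℝ (Fin n) → ℝ) (x : EuclideanSpace ℝ (Fin n)) (k : Fin n) : ℝ :=
  max (if prevPoint h x k ∈ Y then (U x - U (prevPoint h x k)) / h else 0)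
    (max (if nextPoint h x k ∈ Y then -((U (nextPoint h x k) - U x) / h) else 0) 0)

/-- `U` solves the upwind discretization of the Eikonal equation `|∇u| f = 1` on the set `Y` of
gridpoints, with boundary values `q` on the exit set `Q`.  Only the values of `U` on `Y ∪ Q`
matter. -/
def IsUpwindSolution {n : ℕ} (h : ℝ) (f : EuclideanSpace ℝ (Fin n) → ℝ)
    (Y Q : Set (EuclideanSpace ℝ (Fin n))) (q U : EuclideanSpace ℝ (Fin n) → ℝ) : Prop :=
  (∀ x ∈ Q, U x = q x) ∧
    ∀ x ∈ Y \ Q, ∑ k, (upwindDiff h Y U x k) ^ 2 = 1 / (f x) ^ 2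

/-- Uniqueness of the upwind neighbors of a grid function `U` on `X` with target `t`: at every
gridpoint other than `t`, and along every axis, the two neighbors never tie for the smaller value
when that value lies below `U x`, that is, when it enters the upwind difference at `x`. -/
def UniqueUpwindNeighbors {n : ℕ} (h : ℝ) (X : Set (EuclideanSpace ℝ (Fin n)))
    (t : EuclideanSpace ℝ (Fin n)) (U : EuclideanSpace ℝ (Fin n) → ℝ) : Prop :=
  ∀ x ∈ X \ {t}, ∀ k, prevPoint h x k ∈ X → nextPoint h x k ∈ X →
    U (prevPoint h x k) = U (nextPoint h x k) → U x ≤ U (nextPoint h x k)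

open Classical in
/-- `α` is the sensitivity coefficient at the gridpoint `x` of the solution `U` on the grid `X`:
turn `x` into an additional exit point with boundary value `q`, keeping the value `0` at `t`;
`α` is the derivative with respect to `q`, at `q = U x`, of the resulting solution at `s`. -/
def IsSensitivityCoefficient {n : ℕ} (h : ℝ) (f : EuclideanSpace ℝ (Fin n) → ℝ)
    (X : Set (EuclideanSpace ℝ (Fin n))) (s t : EuclideanSpace ℝ (Fin n))
    (U : EuclideanSpace ℝ (Fin n) → ℝ) (x : EuclideanSpace ℝ (Fin n)) (α : ℝ) : Prop :=
  ∃ W : ℝ → EuclideanSpace ℝ (Fin n) → ℝ,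
    (∀ᶠ q in 𝓝 (U x),
      IsUpwindSolution h f X {t, x} (Function.update (fun _ => 0) x q) (W q)) ∧
    HasDerivAt (fun q => W q s) α (U x)

/-! ### The upwind neighbor -/

/-! Write `D k` for the upwind differences of `U` at a point. The upwind equation says that the
vector `D` has length `1 / f`. Hence, by Cauchy–Schwarz, the directions chosen by `U` are suboptimal
for any other solution `V` (`sum_mul_sub_sub_nonpos`), and `V - U` is at most its average, with
weights `D k`, over the upwind neighbors of `U`. Upwind neighbors have strictly smaller values, so
such inequalities propagate by induction along the values. With the weights of `Uhat`, this gives `U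
≤ Uhat`. With the weights of `U`, `Uhat - U` is compared with averaging functions `v x` that are `1`
at a removed point `x` and `0` at `t`. These solve the linearized upwind system, so `v x s` is the
sensitivity coefficient at `x` (`exists_isSensitivityCoefficient`, by the inverse function theorem).
A crude polynomial bound on `Uhat` then yields `Uhat s - U s ≤ |X|² (h / F₁) δ`, where `δ` bounds
the removed coefficients (`sub_le_of_sensitivity_le`). The conjecture makes `δ` exponentially small
in a positive power of `1 / h`, precisely because `μ < 1/2`. -/

open Classical in
/-- The neighbor of `x` along the `k`-th axis that enters the upwind difference of `U`. -/
noncomputable def upwindNeighbor {n : ℕ} (h : ℝ) (Y : Set (EuclideanSpace ℝ (Fin n)))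
    (U : EuclideanSpace ℝ (Fin n) → ℝ) (x : EuclideanSpace ℝ (Fin n)) (k : Fin n) :
    EuclideanSpace ℝ (Fin n) :=
  if prevPoint h x k ∈ Y ∧ (nextPoint h x k ∈ Y → U (prevPoint h x k) < U (nextPoint h x k)) then
    prevPoint h x k
  else nextPoint h x k

section Upwind

variable {n : ℕ} {h : ℝ} {Y : Set (EuclideanSpace ℝ (Fin n))}
  {U V : EuclideanSpace ℝ (Fin n) → ℝ} {x : EuclideanSpace ℝ (Fin n)} {k : Fin n}

theorem upwindDiff_nonneg : 0 ≤ upwindDiff h Y U x k :=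
  (le_max_right _ _).trans (le_max_right _ _)

theorem upwindNeighbor_eq_or :
    upwindNeighbor h Y U x k = prevPoint h x k ∨ upwindNeighbor h Y U x k = nextPoint h x k := by
  unfold upwindNeighbor
  split_ifs <;> simp

theorem upwindDiff_congr (hx : x ∈ Y) (hUV : Set.EqOn U V Y) :
    upwindDiff h Y U x k = upwindDiff h Y V x k := by
  unfold upwindDiff
  congr 1
  · split_ifs with hp
    · rw [hUV hx, hUV hp]
    · rfl
  · congr 1
    split_ifs with hp
    · rw [hUV hx, hUV hp]
    · rfl

/-- No upwind choice is involved: `m` may be the neighbor selected by a different grid function,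
which is how two solutions get compared. -/
theorem sub_le_mul_upwindDiff (hh : 0 < h) {m : EuclideanSpace ℝ (Fin n)}
    (hm : m = prevPoint h x k ∨ m = nextPoint h x k) (hmY : m ∈ Y) :
    U x - U m ≤ h * upwindDiff h Y U x k := by
  rw [← div_le_iff₀' hh]
  rcases hm with rfl | rfl
  · refine le_trans (le_of_eq ?_) (le_max_left _ _)
    rw [if_pos hmY]
  · refine le_trans (le_of_eq ?_) ((le_max_left _ _).trans (le_max_right _ _))
    rw [if_pos hmY]
    ring

/-- Positivity is essential: where the difference vanishes, the selected point may lie outside `Y`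
or carry a larger value. Such directions have weight zero in all the sums below. -/
theorem upwindNeighbor_spec (hh : 0 < h) (hD : 0 < upwindDiff h Y U x k) :
    upwindNeighbor h Y U x k ∈ Y ∧
      U x - U (upwindNeighbor h Y U x k) = h * upwindDiff h Y U x k := by
  unfold upwindNeighbor
  by_cases hp : prevPoint h x k ∈ Y
  · by_cases hn : nextPoint h x k ∈ Y
    · by_cases hlt : U (prevPoint h x k) < U (nextPoint h x k)
      · rw [if_pos ⟨hp, fun _ => hlt⟩]
        refine ⟨hp, ?_⟩
        have h1 : -((U (nextPoint h x k) - U x) / h) < (U x - U (prevPoint h x k)) / h := by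
          rw [← neg_div, div_lt_div_iff_of_pos_right hh]; linarith
        unfold upwindDiff at hD ⊢
        rw [if_pos hp, if_pos hn] at hD ⊢
        rw [lt_max_iff, lt_max_iff] at hD
        have h2 : 0 < (U x - U (prevPoint h x k)) / h := by
          rcases hD with hD | hD | hD
          · exact hD
          · exact hD.trans h1
          · exact absurd hD (lt_irrefl _)
        rw [max_eq_left (max_le h1.le h2.le)]
        field_simp
      · rw [if_neg (fun hc => hlt (hc.2 hn))]
        refine ⟨hn, ?_⟩
        have h1 : (U x - U (prevPoint h x k)) / h ≤ -((U (nextPoint h x k) - U x) / h) := by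
          rw [← neg_div, div_le_div_iff_of_pos_right hh]; linarith
        unfold upwindDiff at hD ⊢
        rw [if_pos hp, if_pos hn] at hD ⊢
        rw [max_eq_right (h1.trans (le_max_left _ _))] at hD ⊢
        rw [lt_max_iff] at hD
        have h2 := hD.resolve_right (lt_irrefl _)
        rw [max_eq_left h2.le]
        field_simp
        ring
    · rw [if_pos ⟨hp, fun hc => absurd hc hn⟩]
      refine ⟨hp, ?_⟩
      unfold upwindDiff at hD ⊢
      rw [if_pos hp, if_neg hn, max_self] at hD ⊢
      have h2 := (lt_max_iff.1 hD).resolve_right (lt_irrefl _)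
      rw [max_eq_left h2.le]
      field_simp
  · rw [if_neg (fun hc => hp hc.1)]
    unfold upwindDiff at hD ⊢
    rw [if_neg hp] at hD ⊢
    by_cases hn : nextPoint h x k ∈ Y
    · refine ⟨hn, ?_⟩
      rw [if_pos hn, max_eq_right (le_max_right _ _)] at hD ⊢
      have h2 := (lt_max_iff.1 hD).resolve_right (lt_irrefl _)
      rw [max_eq_left h2.le]
      field_simp
      ring
    · simp [hn] at hD

theorem upwindNeighbor_lt (hh : 0 < h) (hD : 0 < upwindDiff h Y U x k) :
    U (upwindNeighbor h Y U x k) < U x := by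
  have := (upwindNeighbor_spec hh hD).2
  have := mul_pos hh hD
  linarith

theorem sum_upwindDiff_pos {F : ℝ} (hF : 0 < F)
    (hsum : ∑ k, upwindDiff h Y U x k ^ 2 = 1 / F ^ 2) : 0 < ∑ k, upwindDiff h Y U x k := by
  refine (Finset.sum_nonneg fun k _ => upwindDiff_nonneg).lt_of_ne fun h0 => ?_
  have h1 := (Finset.sum_eq_zero_iff_of_nonneg fun k _ => upwindDiff_nonneg).1 h0.symm
  rw [Finset.sum_eq_zero fun k hk => by rw [h1 k hk]; simp] at hsum
  have : 0 < 1 / F ^ 2 := by positivity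
  exact this.ne hsum

/-- The directions of one upwind solution are suboptimal for another grid function of the same
slope. -/
theorem sum_mul_sub_sub_nonpos {ι : Type*} [Fintype ι] {D D' A B : ι → ℝ} {S : ℝ}
    (hh : 0 < h) (hD : ∀ k, 0 ≤ D k) (hDS : ∑ k, D k ^ 2 = S) (hDS' : ∑ k, D' k ^ 2 = S)
    (hA : ∀ k, 0 < D k → A k = h * D k) (hB : ∀ k, 0 < D k → B k ≤ h * D' k) :
    ∑ k, D k * (B k - A k) ≤ 0 := by
  -- Termwise AM-GM, `D k * D' k ≤ (D k ^ 2 + D' k ^ 2) / 2`; the right-hand sides cancel on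
  -- summation because both squared lengths equal `S`.
  have h1 : ∀ k ∈ Finset.univ, D k * (B k - A k) ≤ h * ((D' k ^ 2 - D k ^ 2) / 2) := by
    intro k _
    rcases (hD k).eq_or_lt with h0 | h0
    · rw [← h0]
      nlinarith [sq_nonneg (D' k)]
    · rw [hA k h0]
      have := mul_le_mul_of_nonneg_left (hB k h0) h0.le
      nlinarith [mul_nonneg hh.le (sq_nonneg (D k - D' k))]
  refine (Finset.sum_le_sum h1).trans (le_of_eq ?_)
  rw [← Finset.mul_sum, ← Finset.sum_div, Finset.sum_sub_distrib, hDS, hDS']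
  simp

end Upwind

/-- Induction along the values of a function on a finite set. -/
theorem Set.Finite.value_induction {α : Type*} {X : Set α} (hX : X.Finite) (U : α → ℝ)
    {p : α → Prop} (hp : ∀ z ∈ X, (∀ w ∈ X, U w < U z → p w) → p z) : ∀ z ∈ X, p z := by
  by_contra! hcon
  obtain ⟨z, hz, hpz⟩ := hcon
  obtain ⟨w, ⟨hwX, hpw⟩, hw⟩ := Set.exists_min_image {z ∈ X | ¬ p z} U
    (hX.subset (Set.sep_subset _ _)) ⟨z, hz, hpz⟩
  refine hpw (hp w hwX fun v hv hlt => ?_)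
  by_contra hpv
  exact absurd (hw v ⟨hv, hpv⟩) (not_le.2 hlt)

/-! ### Bounds and comparison for upwind solutions -/

section Solutions

variable {n : ℕ} {h : ℝ} {f : EuclideanSpace ℝ (Fin n) → ℝ}
  {X Y : Set (EuclideanSpace ℝ (Fin n))} {U V : EuclideanSpace ℝ (Fin n) → ℝ}
  {t : EuclideanSpace ℝ (Fin n)}

theorem IsUpwindSolution.nonneg (hh : 0 < h) (hX : X.Finite) (hf : ∀ z ∈ X, 0 < f z)
    (hU : IsUpwindSolution h f X {t} (fun _ => 0) U) : ∀ z ∈ X, 0 ≤ U z := by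
  refine hX.value_induction U fun z hz ih => ?_
  by_cases hzt : z = t
  · exact (hU.1 z hzt).ge
  · obtain ⟨k, -, hk⟩ := Finset.exists_lt_of_sum_lt
      (f := fun _ : Fin n => (0 : ℝ)) (by simpa using sum_upwindDiff_pos (hf z hz) (hU.2 z ⟨hz, hzt⟩))
    have hlt := upwindNeighbor_lt hh hk
    exact (ih _ (upwindNeighbor_spec hh hk).1 hlt).trans hlt.le

theorem upwindDiff_le {F x} (hF : 0 < F) (hsum : ∑ k, upwindDiff h Y U x k ^ 2 = 1 / F ^ 2)
    (k : Fin n) : upwindDiff h Y U x k ≤ 1 / F := by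
  refine le_of_sq_le_sq ?_ (by positivity)
  rw [div_pow, one_pow, ← hsum]
  exact Finset.single_le_sum (f := fun k => upwindDiff h Y U x k ^ 2)
    (fun k _ => sq_nonneg _) (Finset.mem_univ k)

/-- A descent through upwind neighbors never revisits a point, and each of its steps lowers the
value by at most `h / F`. -/
theorem IsUpwindSolution.le_ncard_mul (hh : 0 < h) (hX : X.Finite) {F : ℝ} (hF : 0 < F)
    (hf : ∀ z ∈ X, F ≤ f z) (hU : IsUpwindSolution h f X {t} (fun _ => 0) U) :
    ∀ z ∈ X, U z ≤ X.ncard * (h / F) := by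
  -- Counting only the points of smaller value makes the bound inductive: each upwind step loses at
  -- least one of them.
  suffices H : ∀ z ∈ X, U z ≤ ({w ∈ X | U w < U z}.ncard : ℝ) * (h / F) by
    intro z hz
    refine (H z hz).trans (mul_le_mul_of_nonneg_right ?_ (by positivity))
    exact_mod_cast Set.ncard_le_ncard (Set.sep_subset _ _) hX
  refine hX.value_induction U fun z hz ih => ?_
  by_cases hzt : z = t
  · rw [hU.1 z hzt]
    positivity
  · have hfz := hF.trans_le (hf z hz)
    have hsum := hU.2 z ⟨hz, hzt⟩
    obtain ⟨k, -, hk⟩ := Finset.exists_lt_of_sum_lt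
      (f := fun _ : Fin n => (0 : ℝ)) (by simpa using sum_upwindDiff_pos hfz hsum)
    obtain ⟨hmem, heq⟩ := upwindNeighbor_spec hh hk
    have hlt := upwindNeighbor_lt hh hk
    have hD : upwindDiff h X U z k ≤ 1 / F :=
      (upwindDiff_le hfz hsum k).trans (one_div_le_one_div_of_le hF (hf z hz))
    have hcard : {w ∈ X | U w < U (upwindNeighbor h X U z k)}.ncard + 1
        ≤ {w ∈ X | U w < U z}.ncard := by
      refine Nat.succ_le_of_lt (Set.ncard_lt_ncard ?_ (hX.subset (Set.sep_subset _ _)))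
      refine ⟨fun w hw => ⟨hw.1, hw.2.trans hlt⟩, fun hsub => ?_⟩
      exact lt_irrefl _ (hsub ⟨hmem, hlt⟩).2
    have hcard' : (({w ∈ X | U w < U (upwindNeighbor h X U z k)}.ncard : ℝ) + 1) * (h / F)
        ≤ ({w ∈ X | U w < U z}.ncard : ℝ) * (h / F) :=
      mul_le_mul_of_nonneg_right (by exact_mod_cast hcard) (by positivity)
    have h1 := ih _ hmem hlt
    have h2 : h * upwindDiff h X U z k ≤ h / F := by
      rw [div_eq_mul_one_div]
      exact mul_le_mul_of_nonneg_left hD hh.le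
    linarith

/-- A bound by weighted averages over the upwind neighbors gives a bound at the point. -/
theorem le_of_sum_upwindDiff_mul_sub_nonpos (hh : 0 < h) {z : EuclideanSpace ℝ (Fin n)}
    {E G : EuclideanSpace ℝ (Fin n) → ℝ} (hpos : 0 < ∑ k, upwindDiff h X U z k)
    (hE : ∑ k, upwindDiff h X U z k * (E z - E (upwindNeighbor h X U z k)) ≤ 0)
    (hG : 0 ≤ ∑ k, upwindDiff h X U z k * (G z - G (upwindNeighbor h X U z k)))
    (hEG : ∀ w ∈ X, U w < U z → E w ≤ G w) : E z ≤ G z := by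
  have h1 : ∑ k, upwindDiff h X U z k * (E z - G z) ≤ 0 := by
    have h2 : ∑ k, upwindDiff h X U z k * (E z - G z) ≤
        ∑ k, upwindDiff h X U z k * (E z - E (upwindNeighbor h X U z k)) -
        ∑ k, upwindDiff h X U z k * (G z - G (upwindNeighbor h X U z k)) := by
      rw [← Finset.sum_sub_distrib]
      refine Finset.sum_le_sum fun k _ => ?_
      rcases upwindDiff_nonneg.eq_or_lt with h0 | h0
      · rw [← h0]
        simp
      · rw [← mul_sub]
        refine mul_le_mul_of_nonneg_left ?_ h0.le
        linarith [hEG _ (upwindNeighbor_spec hh h0).1 (upwindNeighbor_lt hh h0)]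
    linarith
  rw [← Finset.sum_mul] at h1
  by_contra! hlt
  exact absurd h1 (not_le.2 (mul_pos hpos (by linarith)))

/-- Removing gridpoints does not decrease the upwind solution. -/
theorem IsUpwindSolution.le_of_subset (hh : 0 < h) (hY : Y.Finite) (hYX : Y ⊆ X)
    (hf : ∀ z ∈ X, 0 < f z) (hU : IsUpwindSolution h f X {t} (fun _ => 0) U)
    (hV : IsUpwindSolution h f Y {t} (fun _ => 0) V) : ∀ z ∈ Y, U z ≤ V z := by
  refine hY.value_induction V fun z hz ih => ?_
  by_cases hzt : z = t
  · rw [hU.1 z hzt, hV.1 z hzt]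
  · have hsum := hV.2 z ⟨hz, hzt⟩
    -- The weights are those of `V`: its upwind neighbors lie in `Y ⊆ X`, so they are also available
    -- to `U`.
    have hE : ∑ k, upwindDiff h Y V z k * ((U z - U (upwindNeighbor h Y V z k)) -
        (V z - V (upwindNeighbor h Y V z k))) ≤ 0 :=
      sum_mul_sub_sub_nonpos hh (fun k => upwindDiff_nonneg) hsum (hU.2 z ⟨hYX hz, hzt⟩)
        (fun k hk => (upwindNeighbor_spec hh hk).2)
        (fun k hk => sub_le_mul_upwindDiff hh upwindNeighbor_eq_or
          (hYX (upwindNeighbor_spec hh hk).1))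
    have := le_of_sum_upwindDiff_mul_sub_nonpos (E := fun w => U w - V w) (G := fun _ => 0) hh
      (sum_upwindDiff_pos (hf z (hYX hz)) hsum)
      (le_trans (le_of_eq (Finset.sum_congr rfl fun k _ => by ring)) hE) (by simp)
      (fun w hw hlt => sub_nonpos.2 (ih w hw hlt))
    exact sub_nonpos.1 this

end Solutions

/-! ### The sensitivity coefficient -/

/-- In `g v ^ 2 - g w ^ 2 = (g v - g w) (g v + g w)` the first factor is Lipschitz and the second
tends to zero. This handles the kink of the upwind difference at zero. -/
theorem hasStrictFDerivAt_sq_of_eq_zero {E : Type*} [NormedAddCommGroup E] [NormedSpace ℝ E]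
    {g : E → ℝ} {K : NNReal} {u : E} (hg : LipschitzWith K g) (h0 : g u = 0) :
    HasStrictFDerivAt (fun v => g v ^ 2) (0 : E →L[ℝ] ℝ) u := by
  rw [hasStrictFDerivAt_iff_isLittleO]
  have h1 : (fun p : E × E => g p.1 - g p.2) =O[𝓝 (u, u)] fun p => ‖p.1 - p.2‖ := by
    refine Asymptotics.IsBigO.of_bound K (Eventually.of_forall fun p => ?_)
    rw [norm_norm, ← dist_eq_norm, ← dist_eq_norm]
    exact hg.dist_le_mul _ _
  have h2 : (fun p : E × E => g p.1 + g p.2) =o[𝓝 (u, u)] fun _ => (1 : ℝ) := by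
    rw [Asymptotics.isLittleO_one_iff]
    have hc : Continuous fun p : E × E => g p.1 + g p.2 :=
      (hg.continuous.comp continuous_fst).add (hg.continuous.comp continuous_snd)
    simpa [h0] using hc.tendsto (u, u)
  have h3 := (h1.mul_isLittleO h2).norm_right
  simp only [mul_one, norm_norm] at h3
  refine (h3.of_norm_right).congr_left fun p => ?_
  simp
  ring

/-- The squared upwind difference is strictly differentiable where the two one-sided differences do
not tie at a positive value. -/
theorem hasStrictFDerivAt_max_sq {E : Type*} [NormedAddCommGroup E] [NormedSpace ℝ E]
    {a b l : E →L[ℝ] ℝ} {u : E} (hab : a u = b u → a u ≤ 0)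
    (hl : 0 < max (a u) (max (b u) 0) → l = if b u < a u then a else b) :
    HasStrictFDerivAt (fun v => max (a v) (max (b v) 0) ^ 2)
      ((2 * max (a u) (max (b u) 0)) • l) u := by
  have key : ∀ a : E →L[ℝ] ℝ, HasStrictFDerivAt (fun v => a v ^ 2) ((2 * a u) • a) u := by
    intro a
    simpa using a.hasStrictFDerivAt.pow 2 (x := u)
  have h0 : 0 ≤ max (a u) (max (b u) 0) := (le_max_right _ _).trans (le_max_right _ _)
  rcases h0.eq_or_lt with h0 | h0
  · rw [← h0, mul_zero, zero_smul]
    exact hasStrictFDerivAt_sq_of_eq_zero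
      (a.lipschitz.max (b.lipschitz.max (LipschitzWith.const' (K := 0) 0))) h0.symm
  · rw [hl h0]
    rcases lt_trichotomy (b u) (a u) with hlt | heq | hlt
    · have ha : 0 < a u := by
        rw [lt_max_iff, lt_max_iff] at h0
        rcases h0 with h0 | h0 | h0
        · exact h0
        · exact h0.trans hlt
        · exact absurd h0 (lt_irrefl _)
      rw [if_pos hlt, max_eq_left (max_le hlt.le ha.le)]
      refine (key a).congr_of_eventuallyEq ?_
      filter_upwards [b.continuous.continuousAt.eventually_lt a.continuous.continuousAt hlt,
        continuousAt_const.eventually_lt a.continuous.continuousAt ha] with v hv hv'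
      rw [max_eq_left (max_le hv.le hv'.le)]
    · have ha := hab heq.symm
      rw [← heq] at ha h0
      simp [ha] at h0
    · have hb : 0 < b u := by
        rw [lt_max_iff, lt_max_iff] at h0
        rcases h0 with h0 | h0 | h0
        · exact h0.trans hlt
        · exact h0
        · exact absurd h0 (lt_irrefl _)
      rw [if_neg hlt.not_gt, max_eq_left hb.le, max_eq_right hlt.le]
      refine (key b).congr_of_eventuallyEq ?_
      filter_upwards [a.continuous.continuousAt.eventually_lt b.continuous.continuousAt hlt,
        continuousAt_const.eventually_lt b.continuous.continuousAt hb] with v hv hv'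
      rw [max_eq_left hv'.le, max_eq_right hv.le]

open Classical in
/-- Evaluation at `z` of the extension by zero of a function on `X`. -/
noncomputable def extendL {α : Type*} (X : Set α) (z : α) : (X → ℝ) →L[ℝ] ℝ :=
  if hz : z ∈ X then ContinuousLinearMap.proj ⟨z, hz⟩ else 0

theorem extendL_of_mem {α : Type*} {X : Set α} {z : α} (hz : z ∈ X) (V : X → ℝ) :
    extendL X z V = V ⟨z, hz⟩ := by
  simp [extendL, hz]

section Sensitivity

variable {n : ℕ} {h : ℝ} {f : EuclideanSpace ℝ (Fin n) → ℝ}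
  {X : Set (EuclideanSpace ℝ (Fin n))} {U : EuclideanSpace ℝ (Fin n) → ℝ}
  {s t x : EuclideanSpace ℝ (Fin n)}

/-- Uniqueness of upwind neighbors excludes ties at a positive difference; the remaining kinks, at
value zero, are smoothed by squaring. -/
theorem hasStrictFDerivAt_upwindDiff_sq [Fintype X] (hh : 0 < h)
    {z : EuclideanSpace ℝ (Fin n)} (hz : z ∈ X) (k : Fin n)
    (huniq : prevPoint h z k ∈ X → nextPoint h z k ∈ X →
      U (prevPoint h z k) = U (nextPoint h z k) → U z ≤ U (nextPoint h z k)) :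
    HasStrictFDerivAt (fun V : X → ℝ => upwindDiff h X (fun w => extendL X w V) z k ^ 2)
      ((2 * upwindDiff h X U z k) •
        (h⁻¹ • (extendL X z - extendL X (upwindNeighbor h X U z k)))) (fun w : X => U w) := by
  classical
  set u : X → ℝ := fun w => U w
  have hu : ∀ w ∈ X, extendL X w u = U w := fun w hw => extendL_of_mem hw u
  set a : (X → ℝ) →L[ℝ] ℝ :=
    if prevPoint h z k ∈ X then h⁻¹ • (extendL X z - extendL X (prevPoint h z k)) else 0 with ha
  set b : (X → ℝ) →L[ℝ] ℝ :=
    if nextPoint h z k ∈ X then h⁻¹ • (extendL X z - extendL X (nextPoint h z k)) else 0 with hb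
  have hD : ∀ V : X → ℝ, upwindDiff h X (fun w => extendL X w V) z k =
      max (a V) (max (b V) 0) := by
    intro V
    unfold upwindDiff
    congr 1
    · rw [ha]
      split_ifs
      · simp [div_eq_inv_mul]
      · rfl
    · congr 1
      rw [hb]
      split_ifs
      · simp only [smul_apply, sub_apply, smul_eq_mul]
        ring
      · rfl
  have hDU : upwindDiff h X U z k = max (a u) (max (b u) 0) := by
    rw [← hD, upwindDiff_congr hz fun w hw => (hu w hw).symm]
  rw [hDU]
  simp only [hD]
  have hau : prevPoint h z k ∈ X → a u = h⁻¹ * (U z - U (prevPoint h z k)) := by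
    intro hp
    rw [ha, if_pos hp]
    simp [hu z hz, hu _ hp]
  have hbu : nextPoint h z k ∈ X → b u = h⁻¹ * (U z - U (nextPoint h z k)) := by
    intro hp
    rw [hb, if_pos hp]
    simp [hu z hz, hu _ hp]
  have hi : 0 < h⁻¹ := inv_pos.2 hh
  refine hasStrictFDerivAt_max_sq (fun hab => ?_) (fun hpos => ?_)
  · by_cases hp : prevPoint h z k ∈ X
    · by_cases hn : nextPoint h z k ∈ X
      · rw [hau hp, hbu hn, mul_right_inj' hi.ne', sub_right_inj] at hab
        rw [hau hp, hab]
        exact mul_nonpos_of_nonneg_of_nonpos hi.le (sub_nonpos.2 (huniq hp hn hab))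
      · rw [hab, hb, if_neg hn]
        simp
    · rw [ha, if_neg hp]
      simp
  · unfold upwindNeighbor
    by_cases hp : prevPoint h z k ∈ X
    · by_cases hn : nextPoint h z k ∈ X
      · have hiff : b u < a u ↔ U (prevPoint h z k) < U (nextPoint h z k) := by
          rw [hau hp, hbu hn, mul_lt_mul_iff_right₀ hi, sub_lt_sub_iff_left]
        by_cases hlt : U (prevPoint h z k) < U (nextPoint h z k)
        · rw [if_pos ⟨hp, fun _ => hlt⟩, if_pos (hiff.2 hlt), ha, if_pos hp]
        · rw [if_neg (fun hc => hlt (hc.2 hn)), if_neg (fun hc => hlt (hiff.1 hc)), hb, if_pos hn]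
      · have hb0 : b = 0 := by rw [hb, if_neg hn]
        rw [hb0] at hpos ⊢
        have : 0 < a u := by simpa using hpos
        rw [if_pos ⟨hp, fun hc => absurd hc hn⟩, if_pos (by simpa using this), ha, if_pos hp]
    · have ha0 : a = 0 := by rw [ha, if_neg hp]
      rw [ha0] at hpos ⊢
      have hbpos : 0 < b u := by simpa using hpos
      have hn : nextPoint h z k ∈ X := by
        by_contra hn
        rw [hb, if_neg hn] at hbpos
        simp at hbpos
      rw [if_neg (fun hc => hp hc.1), if_neg (by simpa using hbpos.le), hb, if_pos hn]

/-- The sensitivity coefficient at `x` is the value at `s` of the function that is `1` at `x`, `0`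
at `t`, and averages its upwind neighbors elsewhere. -/
theorem exists_isSensitivityCoefficient (hh : 0 < h) (hX : X.Finite) (hf : ∀ z ∈ X, 0 < f z)
    (hU : IsUpwindSolution h f X {t} (fun _ => 0) U) (huniq : UniqueUpwindNeighbors h X t U)
    (ht : t ∈ X) (hx : x ∈ X) (hxt : x ≠ t) :
    ∃ v : EuclideanSpace ℝ (Fin n) → ℝ, v t = 0 ∧ v x = 1 ∧
      (∀ z ∈ X, z ≠ t → z ≠ x →
        ∑ k, upwindDiff h X U z k * (v z - v (upwindNeighbor h X U z k)) = 0) ∧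
      IsSensitivityCoefficient h f X s t U x (v s) := by
  classical
  have : Fintype X := hX.fintype
  set u : X → ℝ := fun w => U w with hudef
  have hu : ∀ w ∈ X, extendL X w u = U w := fun w hw => extendL_of_mem hw u
  -- Identity rows at `t` and `x` put the boundary values into the system, so changing `q` only
  -- moves one coordinate of the right-hand side.
  set Φ : (X → ℝ) → X → ℝ := fun V z => if z.1 = t ∨ z.1 = x then V z else
    ∑ k, upwindDiff h X (fun w => extendL X w V) z k ^ 2 with hΦ
  set L : (X → ℝ) →L[ℝ] (X → ℝ) := ContinuousLinearMap.pi fun z =>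
    if z.1 = t ∨ z.1 = x then ContinuousLinearMap.proj z else
    ∑ k, (2 * upwindDiff h X U z k) •
        (h⁻¹ • (extendL X z - extendL X (upwindNeighbor h X U z k))) with hL
  have hΦL : HasStrictFDerivAt Φ L u := by
    rw [hasStrictFDerivAt_pi']
    intro z
    by_cases hz : z.1 = t ∨ z.1 = x
    · have h1 : (fun V => Φ V z) = fun V => (ContinuousLinearMap.proj (R := ℝ) z : (X → ℝ) →L[ℝ] ℝ) V := by
        funext V
        simp [hΦ, hz]
      have h2 : (ContinuousLinearMap.proj z).comp L =
          (ContinuousLinearMap.proj (R := ℝ) z : (X → ℝ) →L[ℝ] ℝ) := by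
        ext V
        simp [hL, hz]
      rw [h1, h2]
      exact ContinuousLinearMap.hasStrictFDerivAt _
    · have h1 : (fun V => Φ V z) = fun V => ∑ k, upwindDiff h X (fun w => extendL X w V) z k ^ 2 := by
        funext V
        simp [hΦ, hz]
      have h2 : (ContinuousLinearMap.proj z).comp L = ∑ k, (2 * upwindDiff h X U z k) •
          (h⁻¹ • (extendL X z - extendL X (upwindNeighbor h X U z k))) := by
        ext V
        simp [hL, hz]
      rw [h1, h2]
      exact HasStrictFDerivAt.fun_sum fun k _ => hasStrictFDerivAt_upwindDiff_sq hh z.2 k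
        (huniq z.1 ⟨z.2, fun hc => hz (Or.inl hc)⟩ k)
  have hLbd : ∀ V : X → ℝ, ∀ z : X, (z.1 = t ∨ z.1 = x) → L V z = V z := by
    intro V z hz
    simp [hL, hz]
  have hLin : ∀ V : X → ℝ, ∀ z : X, ¬ (z.1 = t ∨ z.1 = x) → L V z = 2 * h⁻¹ *
      ∑ k, upwindDiff h X U z k *
        (extendL X z V - extendL X (upwindNeighbor h X U z k) V) := by
    intro V z hz
    simp only [hL, ContinuousLinearMap.coe_pi', if_neg hz, sum_apply,
      smul_apply, sub_apply, smul_eq_mul]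
    rw [Finset.mul_sum]
    exact Finset.sum_congr rfl fun k _ => by ring
  have hi : 2 * h⁻¹ ≠ 0 := by positivity
  -- Ordered by increasing `U`, the system is triangular with nonzero diagonal: each averaging row
  -- involves only strictly lower neighbors.
  have hinj : Function.Injective (L : (X → ℝ) →ₗ[ℝ] (X → ℝ)) := by
    rw [← LinearMap.ker_eq_bot, LinearMap.ker_eq_bot']
    intro V hV
    have hV' : ∀ z, L V z = 0 := fun z => congrFun hV z
    have h0 : ∀ z ∈ X, extendL X z V = 0 := by
      refine hX.value_induction U fun z hz ih => ?_
      by_cases hzb : z = t ∨ z = x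
      · rw [extendL_of_mem hz, ← hLbd V ⟨z, hz⟩ hzb]
        exact hV' _
      · have h1 := hV' ⟨z, hz⟩
        rw [hLin V ⟨z, hz⟩ hzb, mul_eq_zero, or_iff_right hi] at h1
        have hsum := sum_upwindDiff_pos (hf z hz) (hU.2 z ⟨hz, fun hc => hzb (Or.inl hc)⟩)
        have h2 : (∑ k, upwindDiff h X U z k) * extendL X z V = 0 := by
          rw [← h1, Finset.sum_mul]
          refine Finset.sum_congr rfl fun k _ => ?_
          rcases upwindDiff_nonneg.eq_or_lt with hk | hk
          · rw [← hk]
            simp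
          · rw [ih _ (upwindNeighbor_spec hh hk).1 (upwindNeighbor_lt hh hk), sub_zero]
        exact (mul_eq_zero.1 h2).resolve_left hsum.ne'
    funext z
    rw [← extendL_of_mem z.2 V, h0 z z.2]
    rfl
  set e : (X → ℝ) ≃L[ℝ] (X → ℝ) :=
    (LinearEquiv.ofInjectiveEndo (L : (X → ℝ) →ₗ[ℝ] (X → ℝ)) hinj).toContinuousLinearEquiv with he
  have heL : (e : (X → ℝ) →L[ℝ] (X → ℝ)) = L := by
    ext V z
    rfl
  rw [← heL] at hΦL
  set i : X := ⟨x, hx⟩ with hidef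
  have hupd : Function.update (Φ u) i (U x) = Φ u := by
    rw [Function.update_eq_self_iff]
    simp [hΦ, hudef, hidef]
  -- The derivative of the local inverse along the `x`-coordinate, hence the derivative of the
  -- perturbed solution in `q`.
  set v : X → ℝ := e.symm (Pi.single i 1) with hv
  have hLv : L v = Pi.single i 1 := by
    rw [← heL, hv]
    exact e.apply_symm_apply _
  have hti : (⟨t, ht⟩ : X) ≠ i := fun hc => hxt (congrArg Subtype.val hc).symm
  refine ⟨fun w => extendL X w v, ?_, ?_, ?_, ?_⟩
  · change extendL X t v = 0
    rw [extendL_of_mem ht, ← hLbd v ⟨t, ht⟩ (Or.inl rfl), hLv, Pi.single_eq_of_ne hti]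
  · change extendL X x v = 1
    rw [extendL_of_mem hx, ← hLbd v ⟨x, hx⟩ (Or.inr rfl), hLv, Pi.single_eq_same]
  · intro z hz hzt hzx
    have h1 := hLin v ⟨z, hz⟩ (by simp [hzt, hzx])
    rw [hLv, Pi.single_eq_of_ne (fun hc => hzx (congrArg Subtype.val hc))] at h1
    exact (mul_eq_zero.1 h1.symm).resolve_left hi
  · refine ⟨fun q w => extendL X w (hΦL.localInverse Φ e u (Function.update (Φ u) i q)), ?_, ?_⟩
    · have hcont : Tendsto (fun q => Function.update (Φ u) i q) (𝓝 (U x)) (𝓝 (Φ u)) := by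
        have := (hasDerivAt_update (Φ u) i (U x)).continuousAt.tendsto
        rwa [hupd] at this
      filter_upwards [hcont.eventually hΦL.eventually_right_inverse] with q hq
      set V := hΦL.localInverse Φ e u (Function.update (Φ u) i q)
      have hq' : ∀ z, Φ V z = Function.update (Φ u) i q z := congrFun hq
      refine ⟨?_, ?_⟩
      · rintro z (rfl | rfl)
        · have h1 := hq' ⟨z, ht⟩
          rw [Function.update_of_ne hti] at h1
          simp only [hΦ, true_or, if_true] at h1
          rw [Function.update_of_ne hxt.symm]
          exact (extendL_of_mem ht V).trans (h1.trans (hU.1 z rfl))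
        · have h1 := hq' i
          rw [Function.update_self] at h1
          simp only [hΦ, hidef, or_true, if_true] at h1
          rw [Function.update_self]
          exact (extendL_of_mem hx V).trans h1
      · rintro z ⟨hz, hzQ⟩
        have hzb : ¬ (z = t ∨ z = x) := hzQ
        have h1 := hq' ⟨z, hz⟩
        rw [Function.update_of_ne (fun hc => hzb (Or.inr (congrArg Subtype.val hc)))] at h1
        simp only [hΦ, if_neg hzb] at h1
        rw [h1, ← hU.2 z ⟨hz, fun hc => hzb (Or.inl hc)⟩]
        exact Finset.sum_congr rfl fun k _ => by rw [upwindDiff_congr hz fun w hw => hu w hw]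
    · have h1 := hΦL.to_localInverse.hasFDerivAt
      rw [← hupd] at h1
      have h2 := h1.comp_hasDerivAt (U x) (hasDerivAt_update (Φ u) i (U x))
      exact (extendL X s).hasFDerivAt.comp_hasDerivAt (U x) h2

end Sensitivity

/-! ### Restricting the grid -/

section Restriction

variable {n : ℕ} {h : ℝ} {f : EuclideanSpace ℝ (Fin n) → ℝ}
  {X Y : Set (EuclideanSpace ℝ (Fin n))} {U V : EuclideanSpace ℝ (Fin n) → ℝ}
  {s t : EuclideanSpace ℝ (Fin n)}

/-- If the sensitivity coefficients of the removed gridpoints are at most `δ`, then their removal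
increases the solution at `s` by at most a multiple of `δ`. -/
theorem IsUpwindSolution.sub_le_of_sensitivity_le (hh : 0 < h) (hX : X.Finite) {F : ℝ} (hF : 0 < F)
    (hf : ∀ z ∈ X, F ≤ f z) (hYX : Y ⊆ X) (hs : s ∈ Y) (ht : t ∈ Y)
    (hU : IsUpwindSolution h f X {t} (fun _ => 0) U)
    (hV : IsUpwindSolution h f Y {t} (fun _ => 0) V) (huniq : UniqueUpwindNeighbors h X t U)
    {δ : ℝ} (hδ : 0 ≤ δ)
    (hsens : ∀ x ∈ X \ Y, ∀ α, IsSensitivityCoefficient h f X s t U x α → α ≤ δ) :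
    V s - U s ≤ X.ncard * (h / F) * (X.ncard * δ) := by
  classical
  have hf0 : ∀ z ∈ X, 0 < f z := fun z hz => hF.trans_le (hf z hz)
  have hpos : ∀ z ∈ X, z ≠ t → 0 < ∑ k, upwindDiff h X U z k := fun z hz hzt =>
    sum_upwindDiff_pos (hf0 z hz) (hU.2 z ⟨hz, hzt⟩)
  -- The membership condition sits inside the existential so that `choose` returns a family indexed
  -- by all points.
  have hex : ∀ x : EuclideanSpace ℝ (Fin n), ∃ v : EuclideanSpace ℝ (Fin n) → ℝ,
      x ∈ X \ Y → v t = 0 ∧ v x = 1 ∧ (∀ z ∈ X, z ≠ t → z ≠ x →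
        ∑ k, upwindDiff h X U z k * (v z - v (upwindNeighbor h X U z k)) = 0) ∧
      IsSensitivityCoefficient h f X s t U x (v s) := by
    intro x
    by_cases hx : x ∈ X \ Y
    · obtain ⟨v, hv⟩ := exists_isSensitivityCoefficient (s := s) hh hX hf0 hU huniq (hYX ht) hx.1
        (fun hc => hx.2 (hc ▸ ht))
      exact ⟨v, fun _ => hv⟩
    · exact ⟨0, fun hc => absurd hc hx⟩
  choose v hv using hex
  have hv0 : ∀ x ∈ X \ Y, ∀ z ∈ X, 0 ≤ v x z := by
    intro x hx
    obtain ⟨h1, h2, h3, -⟩ := hv x hx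
    refine hX.value_induction U fun z hz ih => ?_
    by_cases hzt : z = t
    · rw [hzt, h1]
    by_cases hzx : z = x
    · rw [hzx, h2]
      exact zero_le_one
    exact le_of_sum_upwindDiff_mul_sub_nonpos (E := fun _ => 0) hh (hpos z hz hzt) (by simp)
      (h3 z hz hzt hzx).ge ih
  set M : ℝ := X.ncard * (h / F) with hM
  have hM0 : 0 ≤ M := by positivity
  have hVM : ∀ z ∈ Y, V z ≤ M := fun z hz =>
    (hV.le_ncard_mul hh (hX.subset hYX) hF (fun z hz => hf z (hYX hz)) z hz).trans
      (mul_le_mul_of_nonneg_right (by exact_mod_cast Set.ncard_le_ncard hYX hX) (by positivity))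
  have hXY : (X \ Y).Finite := hX.subset Set.sdiff_subset
  set R : Finset (EuclideanSpace ℝ (Fin n)) := hXY.toFinset with hR
  have hRmem : ∀ {x}, x ∈ R ↔ x ∈ X \ Y := hXY.mem_toFinset
  -- `M` is a finite substitute for the value `+∞` off `Y`: since `V ≤ M` on `Y`, a neighbor with
  -- value `M` creates no positive difference.
  set W : EuclideanSpace ℝ (Fin n) → ℝ := fun w => if w ∈ Y then V w else M with hW
  have key : ∀ z ∈ X, W z - U z ≤ M * ∑ x ∈ R, v x z := by
    refine hX.value_induction U fun z hz ih => ?_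
    have hsum0 : ∀ z ∈ X, 0 ≤ ∑ x ∈ R, v x z := fun z hz =>
      Finset.sum_nonneg fun x hx => hv0 x (hRmem.1 hx) z hz
    by_cases hzt : z = t
    · have h1 : W z - U z = 0 := by
        rw [hU.1 z hzt, hW]
        simp only
        rw [if_pos (hzt ▸ ht), hV.1 z hzt, sub_zero]
      rw [h1]
      exact mul_nonneg hM0 (hsum0 z hz)
    by_cases hzY : z ∈ Y
    · have hsum := hU.2 z ⟨hz, hzt⟩
      have hE : ∑ k, upwindDiff h X U z k * ((W z - W (upwindNeighbor h X U z k)) -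
          (U z - U (upwindNeighbor h X U z k))) ≤ 0 := by
        refine sum_mul_sub_sub_nonpos hh (fun k => upwindDiff_nonneg) hsum (hV.2 z ⟨hzY, hzt⟩)
          (fun k hk => (upwindNeighbor_spec hh hk).2) (fun k hk => ?_)
        simp only [hW, if_pos hzY]
        split_ifs with hnb
        · exact sub_le_mul_upwindDiff hh upwindNeighbor_eq_or hnb
        · exact (sub_nonpos.2 (hVM z hzY)).trans (mul_nonneg hh.le upwindDiff_nonneg)
      refine le_of_sum_upwindDiff_mul_sub_nonpos (E := fun w => W w - U w)
        (G := fun w => M * ∑ x ∈ R, v x w) hh (hpos z hz hzt)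
        (le_trans (le_of_eq (Finset.sum_congr rfl fun k _ => by ring)) hE) ?_ ih
      -- Each `v x` averages its neighbors at `z`, because `z ∈ Y` differs from the removed point
      -- `x`.
      refine ge_of_eq ?_
      calc ∑ k, upwindDiff h X U z k *
            (M * ∑ x ∈ R, v x z - M * ∑ x ∈ R, v x (upwindNeighbor h X U z k))
          = M * ∑ x ∈ R, ∑ k, upwindDiff h X U z k *
              (v x z - v x (upwindNeighbor h X U z k)) := by
            simp only [mul_sub, Finset.sum_sub_distrib, Finset.mul_sum]
            congr 1 <;>
            · rw [Finset.sum_comm]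
              exact Finset.sum_congr rfl fun x _ => Finset.sum_congr rfl fun k _ => by ring
        _ = 0 := by
            refine mul_eq_zero_of_right _ (Finset.sum_eq_zero fun x hx => ?_)
            have hx' := hRmem.1 hx
            exact (hv x hx').2.2.1 z hz hzt fun hc => hx'.2 (hc ▸ hzY)
    -- At a removed point the term `v z z = 1` alone already gives the bound `M`, and `U z ≥ 0`.
    · have hzR : z ∈ R := hRmem.2 ⟨hz, hzY⟩
      have h1 : 1 ≤ ∑ x ∈ R, v x z := by
        rw [← (hv z ⟨hz, hzY⟩).2.1]
        exact Finset.single_le_sum (f := fun x => v x z)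
          (fun x hx => hv0 x (hRmem.1 hx) z hz) hzR
      have h2 : W z = M := if_neg hzY
      have h3 := hU.nonneg hh hX hf0 z hz
      nlinarith
  have h1 := key s (hYX hs)
  rw [show W s = V s from if_pos hs] at h1
  refine h1.trans (mul_le_mul_of_nonneg_left ?_ hM0)
  have h2 : ∑ x ∈ R, v x s ≤ R.card • δ := Finset.sum_le_card_nsmul _ _ _ fun x hx =>
    hsens x (hRmem.1 hx) _ (hv x (hRmem.1 hx)).2.2.2
  rw [nsmul_eq_mul] at h2
  refine h2.trans (mul_le_mul_of_nonneg_right ?_ hδ)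
  rw [hR, ← Set.ncard_eq_toFinset_card _ hXY]
  exact_mod_cast Set.ncard_le_ncard Set.sdiff_subset hX

end Restriction

/-! ### The grid -/

theorem cartesianGrid_subset_image (n N : ℕ) : cartesianGrid n N ⊆
    (fun i : Fin n → Fin (N + 1) => WithLp.toLp 2 fun k => ((i k : ℕ) : ℝ) / (N : ℝ)) ''
      Set.univ := by
  intro x hx
  choose i hi hxi using hx
  refine ⟨fun k => ⟨i k, Nat.lt_succ_of_le (hi k)⟩, trivial, ?_⟩
  ext k
  simp [hxi k]

theorem cartesianGrid_finite (n N : ℕ) : (cartesianGrid n N).Finite :=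
  (Set.finite_univ.image _).subset (cartesianGrid_subset_image n N)

theorem ncard_cartesianGrid_le (n N : ℕ) : (cartesianGrid n N).ncard ≤ (N + 1) ^ n := by
  refine (Set.ncard_le_ncard (cartesianGrid_subset_image n N)
    (Set.finite_univ.image _)).trans ((Set.ncard_image_le Set.finite_univ).trans ?_)
  rw [Set.ncard_univ]
  simp

theorem cartesianGrid_subset_unitCube {n N : ℕ} (hN : 0 < N) : cartesianGrid n N ⊆ unitCube n := by
  intro x hx k
  obtain ⟨i, hi, hxi⟩ := hx k
  have hN' : (0 : ℝ) < N := by exact_mod_cast hN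
  rw [hxi, div_le_one hN']
  exact ⟨by positivity, by exact_mod_cast hi⟩

theorem tendsto_pow_mul_exp_neg_rpow_atTop (m : ℕ) {b p : ℝ} (hb : 0 < b) (hp : 0 < p) :
    Tendsto (fun x : ℝ => x ^ m * Real.exp (-b * x ^ p)) atTop (𝓝 0) := by
  refine ((tendsto_rpow_mul_exp_neg_mul_atTop_nhds_zero (m / p) b hb).comp
    (tendsto_rpow_atTop hp)).congr' ?_
  filter_upwards [eventually_ge_atTop 0] with x hx
  simp only [Function.comp]
  rw [← Real.rpow_mul hx, mul_div_cancel₀ _ hp.ne', Real.rpow_natCast]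

/-! ### The limit along the grids -/

theorem mainTheorem1 (n : ℕ)
    -- the speed function, bounded between positive constants
    (f : EuclideanSpace ℝ (Fin n) → ℝ) (F₁ F₂ : ℝ) (hF₁ : 0 < F₁)
    (hf : ∀ x ∈ unitCube n, F₁ ≤ f x ∧ f x ≤ F₂)
    -- source, target, and the unique optimal trajectory between them
    (s t : EuclideanSpace ℝ (Fin n)) (T : ℝ) (y : ℝ → EuclideanSpace ℝ (Fin n))
    (hy : IsOptimalTrajectory f s t T y)
    (hy_unique : ∀ T' y', IsOptimalTrajectory f s t T' y' →
      T' = T ∧ Set.EqOn y' y (Set.Icc 0 T))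
    -- a family of grids with spacing `h k = 1 / N k` tending to zero
    (N : ℕ → ℕ) (hN_pos : ∀ k, 0 < N k) (hN : Tendsto N atTop atTop)
    (h : ℕ → ℝ) (hh : ∀ k, h k = 1 / (N k : ℝ))
    (X : ℕ → Set (EuclideanSpace ℝ (Fin n))) (hX : ∀ k, X k = cartesianGrid n (N k))
    (hs : ∀ k, s ∈ X k) (ht : ∀ k, t ∈ X k)
    -- the distance to the optimal trajectory
    (d : EuclideanSpace ℝ (Fin n) → ℝ)
    (hd : ∀ x, d x = Metric.infDist x (y '' Set.Icc 0 T))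
    -- the restricted grids, with radius of exact order `h ^ μ`
    (μ : ℝ) (hμ : μ ∈ Set.Ico (0 : ℝ) (1 / 2)) (r : ℕ → ℝ) (c C : ℝ) (hc : 0 < c)
    (hr : ∀ᶠ k in atTop, c * h k ^ μ ≤ r k ∧ r k ≤ C * h k ^ μ)
    (Xhat : ℕ → Set (EuclideanSpace ℝ (Fin n)))
    (hXhat : ∀ k, Xhat k = {x ∈ X k | d x < r k})
    -- the numerical solutions on the full and on the restricted grids
    (U Uhat : ℕ → EuclideanSpace ℝ (Fin n) → ℝ)
    (hU : ∀ᶠ k in atTop, IsUpwindSolution (h k) f (X k) {t} (fun _ => 0) (U k))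
    (hUhat : ∀ᶠ k in atTop, IsUpwindSolution (h k) f (Xhat k) {t} (fun _ => 0) (Uhat k))
    (hU_unique : ∀ᶠ k in atTop, UniqueUpwindNeighbors (h k) (X k) t (U k))
    -- the conjectured decay of the sensitivity coefficients
    (hconj : ∃ ρ : ℝ, 0 < ρ ∧ ∀ᶠ k in atTop, ∀ x ∈ X k \ {t}, ∀ α : ℝ,
      IsSensitivityCoefficient (h k) f (X k) s t (U k) x α →
        α ≤ Real.exp (-ρ * d x ^ 2 / h k)) :
    Tendsto (fun k => Uhat k s - U k s) atTop (𝓝 0) := by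

  obtain ⟨ρ, hρ, hconj⟩ := hconj
  obtain ⟨hμ0, hμ1⟩ := hμ
  have hNpos : ∀ k, (0 : ℝ) < N k := fun k => by exact_mod_cast hN_pos k
  have hhpos : ∀ k, 0 < h k := fun k => by rw [hh]; exact one_div_pos.2 (hNpos k)
  have hT := hy.1.nonneg
  have hys : y 0 = s := by
    obtain ⟨a, -, -, -, ha⟩ := hy.1.dynamics
    simpa using ha 0 (Set.left_mem_Icc.2 hT)
  have hds : d s = 0 := by
    rw [hd]
    exact Metric.infDist_zero_of_mem ⟨0, Set.left_mem_Icc.2 hT, hys⟩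
  have hdt : d t = 0 := by
    rw [hd]
    exact Metric.infDist_zero_of_mem ⟨T, Set.right_mem_Icc.2 hT, hy.1.arrival⟩
  -- For a removed point `d x ≥ c * h ^ μ`, so `ρ * d x ^ 2 / h ≥ ρ * c ^ 2 * h ^ (2 * μ - 1) = b *
  -- N ^ p`.
  set b : ℝ := ρ * c ^ 2 with hb
  set p : ℝ := 1 - 2 * μ with hp
  have hb0 : 0 < b := by positivity
  have hp0 : 0 < p := by rw [hp]; linarith
  -- The prefactor comes from two factors `|X| ≤ (N + 1) ^ n ≤ (2 * N) ^ n` and the crude bound `h ≤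
  -- 1`.
  have hlim : Tendsto (fun k => 2 ^ (2 * n) / F₁ *
      ((N k : ℝ) ^ (2 * n) * Real.exp (-b * (N k : ℝ) ^ p))) atTop (𝓝 0) := by
    have h1 := (tendsto_pow_mul_exp_neg_rpow_atTop (2 * n) hb0 hp0).comp
      (tendsto_natCast_atTop_atTop.comp hN)
    simpa using h1.const_mul (2 ^ (2 * n) / F₁)
  have hbound : ∀ᶠ k in atTop, 0 ≤ Uhat k s - U k s ∧ Uhat k s - U k s ≤
      2 ^ (2 * n) / F₁ * ((N k : ℝ) ^ (2 * n) * Real.exp (-b * (N k : ℝ) ^ p)) := by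
    filter_upwards [hr, hU, hUhat, hU_unique, hconj] with k hrk hUk hVk huk hck
    have hNk := hNpos k
    have hhk := hhpos k
    have hcr : 0 < c * h k ^ μ := mul_pos hc (Real.rpow_pos_of_pos hhk μ)
    have hr0 : 0 < r k := hcr.trans_le hrk.1
    have hYX : Xhat k ⊆ X k := by
      rw [hXhat]
      exact Set.sep_subset _ _
    have hsY : s ∈ Xhat k := by
      rw [hXhat]
      exact ⟨hs k, by rwa [hds]⟩
    have htY : t ∈ Xhat k := by
      rw [hXhat]
      exact ⟨ht k, by rwa [hdt]⟩
    have hXfin : (X k).Finite := by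
      rw [hX]
      exact cartesianGrid_finite n (N k)
    have hfX : ∀ z ∈ X k, F₁ ≤ f z := fun z hz =>
      (hf z (cartesianGrid_subset_unitCube (hN_pos k) (hX k ▸ hz))).1
    refine ⟨sub_nonneg.2 (hUk.le_of_subset hhk (hXfin.subset hYX) hYX
      (fun z hz => hF₁.trans_le (hfX z hz)) hVk s hsY), ?_⟩
    have hexp : ∀ x ∈ X k \ Xhat k, ∀ α,
        IsSensitivityCoefficient (h k) f (X k) s t (U k) x α →
          α ≤ Real.exp (-b * (N k : ℝ) ^ p) := by
      intro x hx α hα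
      have hxt : x ≠ t := fun hc => hx.2 (hc ▸ htY)
      refine (hck x ⟨hx.1, hxt⟩ α hα).trans (Real.exp_le_exp.2 ?_)
      have hdx : c * h k ^ μ ≤ d x := by
        refine hrk.1.trans (not_lt.1 fun hlt => hx.2 ?_)
        rw [hXhat]
        exact ⟨hx.1, hlt⟩
      have hsq : c ^ 2 * (h k ^ μ) ^ 2 ≤ d x ^ 2 := by
        rw [← mul_pow]
        exact pow_le_pow_left₀ hcr.le hdx 2
      have hpow : (N k : ℝ) ^ p = (h k ^ μ) ^ 2 / h k := by
        rw [hp, hh, one_div, Real.inv_rpow hNk.le, ← Real.rpow_neg hNk.le, ← Real.rpow_natCast,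
          ← Real.rpow_mul hNk.le, div_inv_eq_mul, ← Real.rpow_add_one hNk.ne']
        congr 1
        push_cast
        ring
      rw [hpow, hb, mul_div_assoc', div_le_div_iff_of_pos_right hhk]
      nlinarith
    refine (hUk.sub_le_of_sensitivity_le hhk hXfin hF₁ hfX hYX hsY htY hVk huk
      (Real.exp_pos _).le hexp).trans ?_
    have hcard : ((X k).ncard : ℝ) ≤ (2 * N k) ^ n := by
      have h1 : (X k).ncard ≤ (2 * N k) ^ n := by
        rw [hX]
        refine (ncard_cartesianGrid_le n (N k)).trans (Nat.pow_le_pow_left ?_ n)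
        have := hN_pos k
        omega
      exact_mod_cast h1
    have hh1 : h k ≤ 1 := by
      rw [hh, div_le_one hNk]
      exact_mod_cast hN_pos k
    calc ((X k).ncard : ℝ) * (h k / F₁) * ((X k).ncard * Real.exp (-b * (N k : ℝ) ^ p))
        ≤ (2 * N k) ^ n * (1 / F₁) * ((2 * N k) ^ n * Real.exp (-b * (N k : ℝ) ^ p)) := by
          gcongr
      _ = _ := by ring
  exact squeeze_zero' (hbound.mono fun k hk => hk.1) (hbound.mono fun k hk => hk.2) hlim
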